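/- Let $(X,d)$ be a uniformly discrete metric space, i.e. there is $\varepsilon>0$ such that $d(x,y)>\varepsilon$ for all $x\neq y$ in $X$. Then the following are equivalent: 1. $X$ has non-measurable cardinal, i.e. there is no countably additive $\{0,1\}$-valued measure $\mu$ defined on all subsets of $X$ with $\mu(X)=1$ and $\mu(\{x\})=0$ for every $x\in X$. 2. $X$ is realcompact, i.e. homeomorphic to a closed subspace of a power $\mathbb R^{I}$ of the real line. 3. $X$ is Samuel realcompact, i.e. $X=H(U_d(X))$. Here $U_d(X)$ is the unital vector lattice of all real-valued uniformly continuous functions on $X$, $H(U_d(X))\subset\mathbb R^{U_d(X)}$ is the space of all real unital vector lattice homomorphisms on $U_d(X)$, and each point $x\in X$ is identified with the evaluation $f\mapsto f(x)$; so the condition says that every such homomorphism is the evaluation at a point of $X$. 4. Every $\alpha$-bounded ultrafilter $\mathfrak F$ in $X$ is fixed, i.e. $\bigcap_{F\in\mathfrak F}F\neq\emptyset$. Here $\mathfrak F$ is called $\alpha$-bounded if every uniformly continuous function $f:X\to\mathbb N$ is bounded on some member of $\mathfrak F$. -/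

import Mathlib

universe u

/-- A cardinal is measurable if a set of that cardinality carries a countably additive
`{0, 1}`-valued measure, defined on all subsets, that gives the whole set measure one and every
point measure zero. -/
def IsMeasurableCardinal (κ : Cardinal.{u}) : Prop :=
  ∃ (α : Type u) (μ : @MeasureTheory.Measure α ⊤), Cardinal.mk α = κ ∧
    (∀ A : Set α, μ A = 0 ∨ μ A = 1) ∧ μ Set.univ = 1 ∧ ∀ x : α, μ {x} = 0

/-- A topological space is realcompact if it is homeomorphic to a closed subspace of a power of the
real line. -/
def IsRealcompact (X : Type u) [TopologicalSpace X] : Prop :=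
  ∃ (ι : Type u) (e : X → ι → ℝ), Topology.IsClosedEmbedding e

/-- A unital vector lattice of real-valued functions on `X`, under the pointwise operations. -/
structure UnitalVectorLattice (X : Type*) extends Submodule ℝ (X → ℝ) where
  one_mem' : (1 : X → ℝ) ∈ carrier
  sup_mem' : ∀ {f g : X → ℝ}, f ∈ carrier → g ∈ carrier → f ⊔ g ∈ carrier
  inf_mem' : ∀ {f g : X → ℝ}, f ∈ carrier → g ∈ carrier → f ⊓ g ∈ carrier

namespace UnitalVectorLattice

variable {X : Type*} (L : UnitalVectorLattice X)

/-- The map `φ : L → ℝ` is a homomorphism of unital vector lattices. -/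
structure IsRealHom (φ : L.toSubmodule → ℝ) : Prop where
  map_add : ∀ f g, φ (f + g) = φ f + φ g
  map_smul : ∀ (c : ℝ) f, φ (c • f) = c * φ f
  map_one : φ ⟨1, L.one_mem'⟩ = 1
  map_sup : ∀ f g : L.toSubmodule, φ ⟨f.1 ⊔ g.1, L.sup_mem' f.2 g.2⟩ = max (φ f) (φ g)
  map_inf : ∀ f g : L.toSubmodule, φ ⟨f.1 ⊓ g.1, L.inf_mem' f.2 g.2⟩ = min (φ f) (φ g)

/-- The space `H(L)` of all real unital vector lattice homomorphisms on `L`; its topology is the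
one inherited from the product `ℝ ^ L`. -/
abbrev H : Type _ := {φ : L.toSubmodule → ℝ // L.IsRealHom φ}

/-- The canonical map `X → H(L)`, which sends a point to the evaluation at that point. -/
def eval (x : X) : L.H :=
  ⟨fun f => f.1 x, fun _ _ => rfl, fun _ _ => rfl, rfl, fun _ _ => rfl, fun _ _ => rfl⟩

end UnitalVectorLattice

/-- The unital vector lattice of all real-valued uniformly continuous functions on a metric
space. -/
def uniformlyContinuousLattice (X : Type*) [MetricSpace X] : UnitalVectorLattice X where
  carrier := {f | UniformContinuous f}
  add_mem' hf hg := UniformContinuous.add hf hg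
  zero_mem' := uniformContinuous_const
  smul_mem' c _ hf := UniformContinuous.const_smul hf c
  one_mem' := uniformContinuous_const
  sup_mem' hf hg := lipschitzWith_max.uniformContinuous.comp (UniformContinuous.prodMk hf hg)
  inf_mem' hf hg := lipschitzWith_min.uniformContinuous.comp (UniformContinuous.prodMk hf hg)

/-- The Samuel realcompactification of a metric space. -/
abbrev SamuelRealcompactification (X : Type*) [MetricSpace X] : Type _ :=
  (uniformlyContinuousLattice X).H

/-- The canonical map of a metric space into its Samuel realcompactification is a topological
embedding. -/
theorem isEmbedding_eval_samuel (X : Type*) [MetricSpace X] :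
    Topology.IsEmbedding
      ((uniformlyContinuousLattice X).eval : X → SamuelRealcompactification X) := by
  have hd : ∀ x : X, (fun y => dist y x) ∈ (uniformlyContinuousLattice X).toSubmodule :=
    fun x => uniformContinuous_id.dist uniformContinuous_const
  have hc : Continuous
      ((uniformlyContinuousLattice X).eval : X → SamuelRealcompactification X) :=
    Continuous.subtype_mk (continuous_pi fun f => UniformContinuous.continuous f.2) _
  refine ⟨Topology.isInducing_iff_nhds.2 fun x => le_antisymm hc.continuousAt.le_comap ?_, ?_⟩
  · rw [Metric.nhds_basis_ball.ge_iff]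
    intro ε hε
    have h1 : Continuous fun φ : SamuelRealcompactification X => φ.1 ⟨_, hd x⟩ :=
      (continuous_apply _).comp continuous_subtype_val
    refine ⟨_, (isOpen_Iio.preimage h1).mem_nhds (?_ : dist x x < ε), fun y hy => hy⟩
    simpa using hε
  · intro x y h
    have := congrFun (congrArg Subtype.val h) ⟨_, hd y⟩
    exact dist_eq_zero.1 (this.trans (dist_self y))

/-- A metric space `X` is Samuel realcompact if `X = H(U_d(X))`, where a point of `X` is identified
with the evaluation at that point. -/
def IsSamuelRealcompact (X : Type*) [MetricSpace X] : Prop :=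
  Set.range ((uniformlyContinuousLattice X).eval : X → SamuelRealcompactification X) = Set.univ

/-- A metric space is uniformly discrete if its distinct points are uniformly far apart. -/
def IsUniformlyDiscrete (X : Type*) [MetricSpace X] : Prop :=
  ∃ ε : ℝ, 0 < ε ∧ ∀ x y : X, x ≠ y → ε < dist x y

/-- A filter in a metric space is `α`-bounded if every uniformly continuous function with values in
the natural numbers is bounded on some member of the filter. -/
def IsAlphaBounded {X : Type*} [MetricSpace X] (F : Filter X) : Prop :=
  ∀ f : X → ℕ, UniformContinuous f → ∃ A ∈ F, Bornology.IsBounded (f '' A)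

/-- A filter is fixed if its members have a common point. -/
def IsFixedFilter {X : Type*} (F : Filter X) : Prop :=
  (⋂₀ F.sets).Nonempty

/-!
In a uniformly discrete space every real-valued function is uniformly continuous, so each of the
four conditions becomes a condition on ultrafilters.

* The sets of measure one under a countably additive `{0, 1}`-valued measure form an ultrafilter
  closed under countable intersections, and every such ultrafilter arises in this way; the points
  are null exactly when the ultrafilter is free. When all functions are uniformly continuous, an
  ultrafilter is closed under countable intersections if and only if it is `α`-bounded
  (`IsAlphaBounded.countableInterFilter`, `isAlphaBounded_of_countableInterFilter`). Hence `X` has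
  non-measurable cardinal if and only if every `α`-bounded ultrafilter is fixed.
* A homomorphism `φ` on the lattice of all functions takes only the values `0` and `1` on
  indicators, so the sets whose indicator has value `1` form an ultrafilter
  (`samuelUltrafilter`). It is `α`-bounded: if `n > φ f` and `{f > n}` were a member, then `φ f`
  would be at least `n`, because `f` dominates `n` times the indicator of that set. If it is
  fixed at `x`, then `φ` is the evaluation at `x`. So if `α`-bounded ultrafilters are fixed, then
  `X` is Samuel realcompact.
* `H(L)` is cut out of `ℝ ^ L` by closed conditions, so a Samuel realcompact space is realcompact.
* Along an `α`-bounded ultrafilter every real function is bounded on some member, hence converges.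
  So the image of the ultrafilter under a closed embedding into `ℝ ^ ι` converges to a point of the
  image, and the ultrafilter converges in the discrete space `X`, i.e. is fixed.
-/

open Filter Topology Set

/-! ### Ultrafilters and two-valued measures -/

theorem isFixedFilter_iff_exists_eq_pure {X : Type*} {F : Ultrafilter X} :
    IsFixedFilter (F : Filter X) ↔ ∃ x, F = pure x := by
  constructor
  · rintro ⟨x, hx⟩
    refine ⟨x, Ultrafilter.eq_of_le fun A hA => ?_⟩
    by_contra h
    exact hx Aᶜ (Ultrafilter.compl_mem_iff_notMem.2 h) hA
  · rintro ⟨x, rfl⟩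
    exact ⟨x, fun A hA => hA⟩

/-- The ultrafilter of sets of measure one (equivalently, of conull sets) of a two-valued
measure defined on all subsets. -/
def twoValuedUltrafilter {α : Type*} (μ : @MeasureTheory.Measure α ⊤)
    (h01 : ∀ A : Set α, μ A = 0 ∨ μ A = 1) (huniv : μ univ = 1) : Ultrafilter α :=
  letI : MeasurableSpace α := ⊤
  Ultrafilter.ofComplNotMemIff (MeasureTheory.ae μ) fun A => by
    rw [MeasureTheory.mem_ae_iff, MeasureTheory.mem_ae_iff, compl_compl]
    have : MeasureTheory.IsFiniteMeasure μ := ⟨by simp [huniv]⟩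
    have h := MeasureTheory.measure_add_measure_compl (μ := μ) (s := A) trivial
    rw [huniv] at h
    rcases h01 A with h0 | h0 <;> rcases h01 Aᶜ with h1 | h1 <;> simp [h0, h1] at h ⊢

/-- The indicator of an ultrafilter closed under countable intersections is a two-valued measure
on all subsets: of countably many disjoint sets at most one is a member, and if none is, neither is
their union. -/
theorem exists_twoValuedMeasure {α : Type*} (F : Ultrafilter α)
    [CountableInterFilter (F : Filter α)] :
    ∃ μ : @MeasureTheory.Measure α ⊤, ∀ A : Set α, (A ∈ F → μ A = 1) ∧ (A ∉ F → μ A = 0) := by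
  classical
  let : MeasurableSpace α := ⊤
  refine ⟨MeasureTheory.Measure.ofMeasurable (fun A _ => if A ∈ F then 1 else 0)
    (if_neg F.empty_notMem) fun f _ hd => ?_, fun A => ?_⟩
  · by_cases h : ∃ i, f i ∈ F
    · obtain ⟨i, hi⟩ := h
      -- Disjoint sets cannot both belong to `F`, so exactly one term of the sum is nonzero.
      rw [tsum_eq_single i, if_pos hi, if_pos (show (⋃ i, f i) ∈ F from mem_of_superset hi (subset_iUnion f i))]
      intro j hj
      refine if_neg fun hj' => F.empty_notMem ?_
      rw [← (hd hj).inter_eq]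
      exact inter_mem hj' hi
    · push Not at h
      have : (⋃ i, f i) ∉ F := by
        rw [← Ultrafilter.compl_mem_iff_notMem, compl_iUnion]
        exact countable_iInter_mem.2 fun i => Ultrafilter.compl_mem_iff_notMem.2 (h i)
      simp [this, h]
  · rw [MeasureTheory.Measure.ofMeasurable_apply A trivial]
    exact ⟨fun h => if_pos h, fun h => if_neg h⟩

theorem isMeasurableCardinal_mk_iff {X : Type u} :
    IsMeasurableCardinal (Cardinal.mk X) ↔
      ∃ F : Ultrafilter X, CountableInterFilter (F : Filter X) ∧ ¬ IsFixedFilter (F : Filter X) := by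
  constructor
  · rintro ⟨α, μ, hα, h01, huniv, hpt⟩
    obtain ⟨e⟩ := Cardinal.eq.1 hα
    let : MeasurableSpace α := ⊤
    have hF : CountableInterFilter (twoValuedUltrafilter μ h01 huniv : Filter α) :=
      inferInstanceAs (CountableInterFilter (MeasureTheory.ae μ))
    refine ⟨(twoValuedUltrafilter μ h01 huniv).map e, ?_, ?_⟩
    · rw [Ultrafilter.coe_map]
      infer_instance
    · rintro ⟨x, hx⟩
      have h : {x}ᶜ ∈ (twoValuedUltrafilter μ h01 huniv).map e := by
        rw [Ultrafilter.mem_map]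
        change μ (e ⁻¹' {x}ᶜ)ᶜ = 0
        rw [preimage_compl, compl_compl, ← e.image_symm_eq_preimage, image_singleton]
        exact hpt _
      exact hx _ h rfl
  · rintro ⟨F, hF, hfree⟩
    obtain ⟨μ, hμ⟩ := exists_twoValuedMeasure F
    refine ⟨X, μ, rfl, fun A => ?_, (hμ _).1 univ_mem, fun x => (hμ _).2 fun hx => hfree ?_⟩
    · by_cases h : A ∈ F
      · exact .inr ((hμ A).1 h)
      · exact .inl ((hμ A).2 h)
    · exact isFixedFilter_iff_exists_eq_pure.2 ⟨x, Ultrafilter.eq_of_le (le_pure_iff.2 hx)⟩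

/-! ### Bounded ultrafilters in uniformly discrete spaces -/

theorem IsUniformlyDiscrete.discreteUniformity {X : Type*} [MetricSpace X]
    (hX : IsUniformlyDiscrete X) : DiscreteUniformity X := by
  obtain ⟨ε, hε, h⟩ := hX
  exact ⟨Metric.uniformSpace_eq_bot.2 ⟨ε, hε, fun x y hxy => (h x y hxy).le⟩⟩

theorem isAlphaBounded_of_countableInterFilter {X : Type*} [MetricSpace X]
    (F : Ultrafilter X) [CountableInterFilter (F : Filter X)] : IsAlphaBounded (F : Filter X) := by
  intro f _
  by_contra! h
  have hn : ∀ n, {x | n < f x} ∈ (F : Filter X) := fun n => by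
    have : {x | f x ≤ n} ∉ F := fun hmem =>
      h _ hmem ((finite_Iic n).subset (image_subset_iff.2 fun x hx => hx)).isBounded
    simpa [compl_ofPred] using Ultrafilter.compl_mem_iff_notMem.2 this
  obtain ⟨x, hx⟩ := F.nonempty_of_mem (countable_iInter_mem.2 hn)
  exact lt_irrefl (f x) (mem_iInter.1 hx (f x))

section DiscreteUniformity

variable {X : Type*} [MetricSpace X] [DiscreteUniformity X]

theorem IsAlphaBounded.countableInterFilter {F : Ultrafilter X}
    (hF : IsAlphaBounded (F : Filter X)) : CountableInterFilter (F : Filter X) := by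
  classical
  refine ⟨fun S hS hmem => ?_⟩
  rcases S.eq_empty_or_nonempty with rfl | hne
  · simp
  obtain ⟨A, rfl⟩ := hS.exists_eq_range hne
  rw [sInter_range]
  have hA : ∀ n, A n ∈ (F : Filter X) := fun n => hmem _ (mem_range_self n)
  -- `f x` is the first index whose set misses `x`; bounding `f` by `N` on a member reduces the
  -- intersection to its first `N + 1` terms.
  let f : X → ℕ := fun x => if h : ∃ n, x ∉ A n then Nat.find h else 0
  obtain ⟨B, hB, hfB⟩ := hF f (DiscreteUniformity.uniformContinuous X f)
  obtain ⟨N, hN⟩ := hfB.bddAbove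
  have hfin : (⋂ n ∈ Iic N, A n) ∈ (F : Filter X) :=
    (biInter_mem (finite_Iic N)).2 fun n _ => hA n
  filter_upwards [hB, hfin] with x hxB hx
  by_contra hnot
  have hex : ∃ n, x ∉ A n := by simpa using hnot
  have hle : Nat.find hex ≤ N := by
    have := hN (mem_image_of_mem f hxB)
    rwa [show f x = Nat.find hex from dif_pos hex] at this
  exact Nat.find_spec hex (mem_iInter₂.1 hx _ hle)

theorem IsAlphaBounded.exists_tendsto {F : Ultrafilter X} (hF : IsAlphaBounded (F : Filter X))
    (f : X → ℝ) : ∃ a, Tendsto f F (𝓝 a) := by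
  obtain ⟨A, hA, hfA⟩ := hF (fun x => ⌈|f x|⌉₊) (DiscreteUniformity.uniformContinuous X _)
  obtain ⟨N, hN⟩ := hfA.bddAbove
  have hmem : Icc (-(N : ℝ)) N ∈ F.map f := by
    rw [Ultrafilter.mem_map]
    filter_upwards [hA] with x hx
    exact abs_le.1 ((Nat.le_ceil _).trans (Nat.cast_le.2 (hN (mem_image_of_mem _ hx))))
  obtain ⟨a, -, ha⟩ := isCompact_Icc.ultrafilter_le_nhds' (F.map f) hmem
  exact ⟨a, ha⟩

/-- A closed embedding into a power of `ℝ` sends an `α`-bounded ultrafilter to a convergent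
ultrafilter, whose limit lies in the closed range. -/
theorem IsAlphaBounded.isFixedFilter_of_isClosedEmbedding {ι : Type*} {e : X → ι → ℝ}
    (he : IsClosedEmbedding e) {F : Ultrafilter X} (hF : IsAlphaBounded (F : Filter X)) :
    IsFixedFilter (F : Filter X) := by
  choose p hp using fun i => hF.exists_tendsto fun x => e x i
  have hlim : Tendsto e F (𝓝 p) := tendsto_pi_nhds.2 hp
  obtain ⟨x, hx⟩ := he.isClosed_range.mem_of_tendsto hlim (.of_forall mem_range_self)
  have hFx : (F : Filter X) ≤ 𝓝 x := by
    rw [he.isInducing.nhds_eq_comap, hx]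
    exact hlim.le_comap
  rw [nhds_discrete] at hFx
  exact isFixedFilter_iff_exists_eq_pure.2 ⟨x, Ultrafilter.eq_of_le hFx⟩

end DiscreteUniformity

/-! ### The space of homomorphisms -/

theorem UnitalVectorLattice.isClosed_setOf_isRealHom {X : Type*} (L : UnitalVectorLattice X) :
    IsClosed {φ : L.toSubmodule → ℝ | L.IsRealHom φ} := by
  have : {φ : L.toSubmodule → ℝ | L.IsRealHom φ} =
      {φ | (∀ f g, φ (f + g) = φ f + φ g) ∧ (∀ (c : ℝ) f, φ (c • f) = c * φ f) ∧
        φ ⟨1, L.one_mem'⟩ = 1 ∧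
        (∀ f g : L.toSubmodule, φ ⟨f.1 ⊔ g.1, L.sup_mem' f.2 g.2⟩ = max (φ f) (φ g)) ∧
        ∀ f g : L.toSubmodule, φ ⟨f.1 ⊓ g.1, L.inf_mem' f.2 g.2⟩ = min (φ f) (φ g)} :=
    Set.ext fun φ => ⟨fun h => ⟨h.1, h.2, h.3, h.4, h.5⟩,
      fun ⟨h1, h2, h3, h4, h5⟩ => ⟨h1, h2, h3, h4, h5⟩⟩
  rw [this]
  simp only [ofPred_and, ofPred_forall]
  refine .inter ?_ (.inter ?_ (.inter ?_ (.inter ?_ ?_)))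
  · exact isClosed_iInter fun f => isClosed_iInter fun g => isClosed_eq (by fun_prop) (by fun_prop)
  · exact isClosed_iInter fun c => isClosed_iInter fun f => isClosed_eq (by fun_prop) (by fun_prop)
  · exact isClosed_eq (by fun_prop) (by fun_prop)
  · exact isClosed_iInter fun f => isClosed_iInter fun g => isClosed_eq (by fun_prop) (by fun_prop)
  · exact isClosed_iInter fun f => isClosed_iInter fun g => isClosed_eq (by fun_prop) (by fun_prop)

theorem IsSamuelRealcompact.isRealcompact {X : Type u} [MetricSpace X]
    (h : IsSamuelRealcompact X) : IsRealcompact X := by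
  have heval : IsClosedEmbedding
      ((uniformlyContinuousLattice X).eval : X → SamuelRealcompactification X) :=
    ⟨isEmbedding_eval_samuel X, by rw [show range _ = univ from h]; exact isClosed_univ⟩
  exact ⟨_, _, (UnitalVectorLattice.isClosed_setOf_isRealHom _).isClosedEmbedding_subtypeVal.comp
    heval⟩

namespace SamuelRealcompactification

variable {X : Type*} [MetricSpace X] [DiscreteUniformity X] (φ : SamuelRealcompactification X)

/-- A homomorphism on the uniformly continuous functions, regarded as defined on all functions;
the two lattices agree in a space with the discrete uniformity. -/
def app (f : X → ℝ) : ℝ :=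
  φ.1 ⟨f, DiscreteUniformity.uniformContinuous X f⟩

theorem app_add (f g : X → ℝ) : φ.app (f + g) = φ.app f + φ.app g :=
  φ.2.map_add ⟨f, DiscreteUniformity.uniformContinuous X f⟩
    ⟨g, DiscreteUniformity.uniformContinuous X g⟩

theorem app_smul (c : ℝ) (f : X → ℝ) : φ.app (c • f) = c * φ.app f :=
  φ.2.map_smul c ⟨f, DiscreteUniformity.uniformContinuous X f⟩

theorem app_one : φ.app 1 = 1 :=
  φ.2.map_one

theorem app_sup (f g : X → ℝ) : φ.app (f ⊔ g) = max (φ.app f) (φ.app g) :=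
  φ.2.map_sup ⟨f, DiscreteUniformity.uniformContinuous X f⟩
    ⟨g, DiscreteUniformity.uniformContinuous X g⟩

theorem app_inf (f g : X → ℝ) : φ.app (f ⊓ g) = min (φ.app f) (φ.app g) :=
  φ.2.map_inf ⟨f, DiscreteUniformity.uniformContinuous X f⟩
    ⟨g, DiscreteUniformity.uniformContinuous X g⟩

theorem app_zero : φ.app 0 = 0 := by
  simpa using φ.app_smul 0 0

theorem app_mono {f g : X → ℝ} (h : f ≤ g) : φ.app f ≤ φ.app g := by
  have := φ.app_sup f g
  rw [sup_eq_right.2 h] at this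
  rw [this]
  exact le_max_left _ _

theorem app_indicator_add_compl (A : Set X) :
    φ.app (A.indicator 1) + φ.app (Aᶜ.indicator 1) = 1 := by
  rw [← app_add, indicator_self_add_compl, app_one]

theorem app_indicator_inter (A B : Set X) :
    φ.app ((A ∩ B).indicator 1) = min (φ.app (A.indicator 1)) (φ.app (B.indicator 1)) := by
  rw [← app_inf]
  congr 1
  ext x
  by_cases hA : x ∈ A <;> by_cases hB : x ∈ B <;> simp [hA, hB]

theorem app_indicator_eq_zero_or_one (A : Set X) :
    φ.app (A.indicator 1) = 0 ∨ φ.app (A.indicator 1) = 1 := by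
  have h1 := φ.app_indicator_add_compl A
  have h2 := φ.app_indicator_inter A Aᶜ
  rw [inter_compl_self, indicator_empty, ← Pi.zero_def, app_zero] at h2
  rcases min_choice (φ.app (A.indicator 1)) (φ.app (Aᶜ.indicator 1)) with h | h
  · exact .inl (h ▸ h2.symm)
  · exact .inr (by linarith)

theorem app_indicator_le_one (A : Set X) : φ.app (A.indicator 1) ≤ 1 := by
  rcases φ.app_indicator_eq_zero_or_one A with h | h <;> simp [h]

/-- The ultrafilter of the sets whose indicator is sent to `1` by a given homomorphism. -/
def samuelUltrafilter : Ultrafilter X :=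
  Ultrafilter.ofComplNotMemIff
    { sets := {A | φ.app (A.indicator 1) = 1}
      univ_sets := by simpa using φ.app_one
      sets_of_superset := fun {A B} hA hAB =>
        le_antisymm (φ.app_indicator_le_one B) <| hA.symm.le.trans <| φ.app_mono <|
          indicator_le_indicator_of_subset hAB fun _ => zero_le_one
      inter_sets := fun {A B} hA hB => by
        rw [mem_ofPred_eq, app_indicator_inter, hA, hB, min_self] }
    fun A => by
      change ¬ φ.app (Aᶜ.indicator 1) = 1 ↔ φ.app (A.indicator 1) = 1
      have h := φ.app_indicator_add_compl A
      rcases φ.app_indicator_eq_zero_or_one A with h0 | h0 <;> rw [h0] at h ⊢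
      · simpa using h
      · simp [show φ.app (Aᶜ.indicator 1) = 0 by linarith]

theorem mem_samuelUltrafilter {A : Set X} :
    A ∈ φ.samuelUltrafilter ↔ φ.app (A.indicator 1) = 1 :=
  Iff.rfl

theorem isAlphaBounded_samuelUltrafilter : IsAlphaBounded (φ.samuelUltrafilter : Filter X) := by
  intro f _
  obtain ⟨n, hn⟩ := exists_nat_gt (φ.app fun x => (f x : ℝ))
  refine ⟨{x | f x ≤ n}, ?_,
    ((finite_Iic n).subset (image_subset_iff.2 fun x hx => hx)).isBounded⟩
  by_contra hA
  have hAc := φ.mem_samuelUltrafilter.1 (Ultrafilter.compl_mem_iff_notMem.2 hA)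
  have hle : (n : ℝ) • {x | f x ≤ n}ᶜ.indicator (1 : X → ℝ) ≤ fun x => (f x : ℝ) := by
    intro x
    by_cases hx : f x ≤ n
    · simp [hx]
    · simpa [hx] using (not_le.1 hx).le
  have := φ.app_mono hle
  rw [app_smul, hAc, mul_one] at this
  exact hn.not_ge this

theorem app_eq_of_samuelUltrafilter_eq_pure {x : X} (h : φ.samuelUltrafilter = pure x)
    (f : X → ℝ) : φ.app f = f x := by
  have hx : φ.app (({x} : Set X).indicator 1) = 1 := by
    rw [← mem_samuelUltrafilter, h]
    exact Ultrafilter.mem_pure.2 rfl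
  set c := φ.app f with hc
  -- `|f - c|` is sent to `0` and dominates `|f x - c|` times the indicator of `{x}`.
  have h0 : φ.app ((f + (-c) • 1) ⊔ ((-1 : ℝ) • f + c • 1)) = 0 := by
    rw [app_sup, app_add, app_add, app_smul, app_smul, app_smul, app_one, ← hc]
    simp
  have hle : |f x - c| • ({x} : Set X).indicator (1 : X → ℝ) ≤
      (f + (-c) • 1) ⊔ ((-1 : ℝ) • f + c • 1) := by
    intro y
    have hsup : ((f + (-c) • 1) ⊔ ((-1 : ℝ) • f + c • 1)) y = |f y - c| := by
      simp [abs_eq_max_neg, sub_eq_add_neg, add_comm]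
    rw [hsup]
    by_cases hy : y = x
    · simp [hy]
    · simp [hy]
  have := φ.app_mono hle
  rw [app_smul, hx, mul_one, h0] at this
  linarith [abs_eq_zero.1 (le_antisymm this (abs_nonneg _))]

end SamuelRealcompactification

theorem isSamuelRealcompact_of_forall_isFixedFilter {X : Type*} [MetricSpace X]
    [DiscreteUniformity X]
    (h : ∀ F : Ultrafilter X, IsAlphaBounded (F : Filter X) → IsFixedFilter (F : Filter X)) :
    IsSamuelRealcompact X := by
  refine eq_univ_of_forall fun φ : SamuelRealcompactification X => ?_
  obtain ⟨x, hx⟩ := isFixedFilter_iff_exists_eq_pure.1 (h _ φ.isAlphaBounded_samuelUltrafilter)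
  exact ⟨x, Subtype.ext <| funext fun f => (φ.app_eq_of_samuelUltrafilter_eq_pure hx f.1).symm⟩

/-! ### The equivalence -/

theorem mainTheorem6 (X : Type u) [MetricSpace X] (hX : IsUniformlyDiscrete X) :
    List.TFAE
      [¬ IsMeasurableCardinal (Cardinal.mk X),
        IsRealcompact X,
        IsSamuelRealcompact X,
        ∀ F : Ultrafilter X, IsAlphaBounded (F : Filter X) → IsFixedFilter (F : Filter X)] := by
  have := hX.discreteUniformity
  tfae_have 1 → 4 := fun h F hF => by
    by_contra hfree
    exact h (isMeasurableCardinal_mk_iff.2 ⟨F, hF.countableInterFilter, hfree⟩)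
  tfae_have 4 → 1 := fun h hmeas => by
    obtain ⟨F, hF, hfree⟩ := isMeasurableCardinal_mk_iff.1 hmeas
    exact hfree (h F (isAlphaBounded_of_countableInterFilter F))
  tfae_have 4 → 3 := isSamuelRealcompact_of_forall_isFixedFilter
  tfae_have 3 → 2 := IsSamuelRealcompact.isRealcompact
  tfae_have 2 → 4 := fun ⟨_, _, he⟩ _ hF => hF.isFixedFilter_of_isClosedEmbedding he
  tfae_finish
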